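/- Let $V\subset\mathbb R^d$ be a finite set and let $\mathcal P=\mathrm{conv}(V)$ be the polytope it spans (for instance, $V$ is the vertex set of $\mathcal P$). Let $D=\max\{\|x-y\|:x,y\in\mathcal P\}$ be its Euclidean diameter. Let the cost vectors $a_1,a_2,\ldots$ be i.i.d. random vectors in $\mathbb R^d$ with $\mathbb E[a_i]=a$ and, almost surely, $\|a_i\|\le L$ and $\|a_i-a\|\le R$ for all $i$. Let $V^*=\mathrm{argmin}\{a\cdot v:v\in V\}$, assume $V\ne V^*$, and for $v\in V$, $v^*\in V^*$ put $\Delta_v=a\cdot(v-v^*)$. Let $\Delta=\min\{\Delta_v:v\in V,\ \Delta_v>0\}$ be the suboptimality gap and $\Delta_d=\max\{\Delta_v:v\in V\}$ the largest gap. Given a base point $y_1\in\mathbb R^d$ and a parameter $\eta>0$, the lazy anytime Subgradient algorithm plays $x_n=P_{\mathcal P}(y_n)$, where $P_{\mathcal P}$ is the Euclidean projection onto $\mathcal P$ and $y_n=y_1-\eta\,\frac{a_1+\cdots+a_{n-1}}{\sqrt{n-1}}$ for $n\ge2$. Let $\|\mathcal P\|=\max\{\|x-y_1\|:x\in\mathcal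 P\}$ and let $x^*\in\mathrm{argmin}\{a\cdot x:x\in\mathcal P\}$. Then the total pseudo-regret $\sum_{i=1}^\infty a\cdot(x_i-x^*)$ converges almost surely and is integrable, and for every $\alpha>3$, with $\beta=\frac13-\frac1\alpha$, $$\mathbb E\Big[\sum_{i=1}^\infty a\cdot(x_i-x^*)\Big]\le LD+\Big(\frac{\|\mathcal P\|^2}{2\eta}+2\eta L^2+\sqrt{\tfrac{\pi}{2}}\,RD\Big)\Big(\frac32\,\frac{\alpha D^2}{\eta\Delta}+\frac{\eta\Delta}{\alpha D^2}\Big)+\frac{4R^2D^2}{\beta^2}\Big(\frac1{\Delta_d}+\frac2\Delta\Big)\exp\Big(-\frac12\Big(\frac{\alpha\beta\|\mathcal P\|}{\eta R}\Big)^2\Big)$$ (the last term being $0$ when $R=0$). In particular, if $y_1\in\mathcal P$ and $\eta=D/(2L)$, then $$\mathbb E\Big[\sum_{i=1}^\infty a\cdot(x_i-x^*)\Big]\le\Big(2LD+\sqrt{\tfrac{\pi}{2}}\,RD\Big)\Big(\frac{30LD}{\Delta}+\frac{11}{20}\Big)+\frac{15R^2D^2}{\Delta},$$ and this expectation is at most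 $C\,L^2D^2/\Delta$ for an absolute constant $C$, which depends on nothing, in particular not on the dimension $d$. -/

import Mathlib

open MeasureTheory ProbabilityTheory

noncomputable section

/-- `p` is a nearest point of `X` to `y`: it minimises `‖z - y‖` over `z ∈ X`. -/
def IsNearestPoint {d : ℕ} (X : Set (EuclideanSpace ℝ (Fin d)))
    (y p : EuclideanSpace ℝ (Fin d)) : Prop :=
  p ∈ X ∧ ∀ z ∈ X, ‖p - y‖ ≤ ‖z - y‖

open Classical in
/-- Euclidean projection of `y` onto `X`.  For `X` nonempty, compact and convex it is the unique
nearest point; the value `y` is only a default for sets without a nearest point. -/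
def euclideanProj {d : ℕ} (X : Set (EuclideanSpace ℝ (Fin d)))
    (y : EuclideanSpace ℝ (Fin d)) : EuclideanSpace ℝ (Fin d) :=
  if h : ∃ p, IsNearestPoint X y p then h.choose else y

theorem euclideanProj_spec {d : ℕ} {X : Set (EuclideanSpace ℝ (Fin d))}
    (hX : IsCompact X) (hne : X.Nonempty) (y : EuclideanSpace ℝ (Fin d)) :
    IsNearestPoint X y (euclideanProj X y) := by
  have h : ∃ p, IsNearestPoint X y p := by
    obtain ⟨p, hp, hmin⟩ := hX.exists_isMinOn (f := fun z => ‖z - y‖) hne (by fun_prop)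
    exact ⟨p, hp, fun z hz => hmin hz⟩
  unfold euclideanProj
  rw [dif_pos h]
  exact h.choose_spec

/-- The unprojected iterate of the lazy anytime subgradient algorithm with base point `y₁`,
parameter `η` and cost vectors `b 0, b 1, …`.  Rounds are counted from `0`, so round `n` is played
after the `n` cost vectors `b 0, …, b (n - 1)` have been received; in round `0` the sum is empty
and the iterate is `y₁`. -/
def subgradientIterate {d : ℕ} (y₁ : EuclideanSpace ℝ (Fin d)) (η : ℝ)
    (b : ℕ → EuclideanSpace ℝ (Fin d)) (n : ℕ) : EuclideanSpace ℝ (Fin d) :=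
  y₁ - η • ((Real.sqrt n)⁻¹ • ∑ i ∈ Finset.range n, b i)

/-- The action played in round `n` (counted from `0`) on the action set `X`. -/
def subgradientAction {d : ℕ} (X : Set (EuclideanSpace ℝ (Fin d)))
    (y₁ : EuclideanSpace ℝ (Fin d)) (η : ℝ)
    (b : ℕ → EuclideanSpace ℝ (Fin d)) (n : ℕ) : EuclideanSpace ℝ (Fin d) :=
  euclideanProj X (subgradientIterate y₁ η b n)

/-- The largest distance from a point of `X` to the base point `y₁`. -/
def maxDistTo {d : ℕ} (X : Set (EuclideanSpace ℝ (Fin d)))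
    (y₁ : EuclideanSpace ℝ (Fin d)) : ℝ :=
  sSup ((fun x => ‖x - y₁‖) '' X)

/-- The elements of the finite set `V` that minimise `v ↦ a · v` over `V`. -/
def optimalVertices {d : ℕ} (V : Finset (EuclideanSpace ℝ (Fin d)))
    (a : EuclideanSpace ℝ (Fin d)) : Set (EuclideanSpace ℝ (Fin d)) :=
  {w | w ∈ V ∧ ∀ v ∈ V, inner ℝ a w ≤ inner ℝ a v}

/-- The finite set of gaps `a · (v - w)`, for `v ∈ V` and `w` an optimal vertex. -/
def vertexGaps {d : ℕ} (V : Finset (EuclideanSpace ℝ (Fin d)))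
    (a : EuclideanSpace ℝ (Fin d)) : Set ℝ :=
  {δ | ∃ v ∈ V, ∃ w ∈ optimalVertices V a, δ = inner ℝ a (v - w)}

/-- The suboptimality gap: the smallest positive gap.  It is a genuine minimum as soon as `V` has
a vertex that is not optimal. -/
def suboptimalityGap {d : ℕ} (V : Finset (EuclideanSpace ℝ (Fin d)))
    (a : EuclideanSpace ℝ (Fin d)) : ℝ :=
  sInf {δ | δ ∈ vertexGaps V a ∧ 0 < δ}

/-- The largest gap. -/
def largestGap {d : ℕ} (V : Finset (EuclideanSpace ℝ (Fin d)))
    (a : EuclideanSpace ℝ (Fin d)) : ℝ :=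
  sSup (vertexGaps V a)

/-- The total pseudo-regret `∑ a · (x_n - x*)` of a sequence of actions over all rounds. -/
def totalPseudoRegret {d : ℕ} (a xstar : EuclideanSpace ℝ (Fin d))
    (x : ℕ → EuclideanSpace ℝ (Fin d)) : ℝ :=
  ∑' n, inner ℝ a (x n - xstar)

end

/-! With `W n` the centred cost sum divided by `√n`, the iterate is `y₁ - η W n - η√n a`: noise
whose size stays of order one plus a drift along `-a` growing like `√n`. Every vertex carrying the
projection is maximal for a linear functional on the polytope. Comparing it with the optimum
(`inner_sub_nearestPoint_le`) bounds the regret of round `n` by `(m + ‖W n‖) D / √n`, where `m = M /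
η`, and makes it exactly zero once `(m + ‖W n‖) D < Δ√n`.

The noise is controlled without the dimension: `cosh ‖·‖` of a sum of independent centred bounded
vectors grows in mean by at most a factor `cosh R` per step, so `‖W n‖` has sub-Gaussian hyperbolic
moments. Beyond `n ≈ (mD/Δ)²` the expected regret therefore has a Gaussian tail. In the variable `s
= Δ√n / D` the sum of the expectations is dominated by an integral
(`summable_integrable_tsum_of_threshold`), giving `LD + (D²/Δ) · q(m, R)` with an explicit quadratic
form `q` (`totalPseudoRegret_le`). Here `R` may be any positive noise bound, in particular `2L`. The
stated inequalities follow by elementary comparison with `q`. -/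

/-! ### Dimension-free moment bounds for sums of independent vectors. -/

/-- The function `z ↦ cosh √z = ∑ zⁿ / (2n)!` is convex on `[0, ∞)`, and the argument is the convex
combination of `(p + q)²` and `(p - q)²` with weights `(1 ± θ) / 2`. The right side is the chord. -/
theorem cosh_sqrt_chord {p q θ : ℝ} (hp : 0 ≤ p) (hq : 0 ≤ q) (h1 : -1 ≤ θ) (h2 : θ ≤ 1) :
    Real.cosh √(p ^ 2 + q ^ 2 + 2 * (p * q * θ)) ≤
      Real.cosh p * Real.cosh q + θ * (Real.sinh p * Real.sinh q) := by
  have hpq : 0 ≤ p * q := mul_nonneg hp hq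
  have hz : 0 ≤ p ^ 2 + q ^ 2 + 2 * (p * q * θ) := by nlinarith [sq_nonneg (p - q)]
  have hsum : HasSum (fun n : ℕ => (1 + θ) / 2 * ((p + q) ^ (2 * n) / ((2 * n).factorial : ℝ)) +
      (1 - θ) / 2 * ((p - q) ^ (2 * n) / ((2 * n).factorial : ℝ)))
      ((1 + θ) / 2 * Real.cosh (p + q) + (1 - θ) / 2 * Real.cosh (p - q)) :=
    ((Real.hasSum_cosh _).mul_left _).add ((Real.hasSum_cosh _).mul_left _)
  have key := hasSum_le (fun n => ?_) (Real.hasSum_cosh √(p ^ 2 + q ^ 2 + 2 * (p * q * θ))) hsum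
  · rw [Real.cosh_add, Real.cosh_sub] at key
    linarith
  · have hc := (convexOn_pow (𝕜 := ℝ) n).2 (sq_nonneg (p + q)) (sq_nonneg (p - q))
      (by linarith : 0 ≤ (1 + θ) / 2) (by linarith : 0 ≤ (1 - θ) / 2) (by ring)
    simp only [smul_eq_mul] at hc
    rw [pow_mul, pow_mul, pow_mul, Real.sq_sqrt hz, ← mul_div_assoc, ← mul_div_assoc, ← add_div]
    gcongr
    calc _ = ((1 + θ) / 2 * (p + q) ^ 2 + (1 - θ) / 2 * (p - q) ^ 2) ^ n := by ring
      _ ≤ _ := hc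

theorem ae_norm_sum_range_le {E Ω : Type*} [NormedAddCommGroup E] [MeasurableSpace Ω]
    {μ : Measure Ω} {X : ℕ → Ω → E} {R : ℝ}
    (hb : ∀ i, ∀ᵐ ω ∂μ, ‖X i ω‖ ≤ R) (n : ℕ) :
    ∀ᵐ ω ∂μ, ‖∑ i ∈ Finset.range n, X i ω‖ ≤ n * R := by
  filter_upwards [ae_all_iff.2 hb] with ω h
  calc _ ≤ ∑ i ∈ Finset.range n, ‖X i ω‖ := norm_sum_le _ _
    _ ≤ ∑ i ∈ Finset.range n, R := Finset.sum_le_sum fun i _ => h i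
    _ = _ := by simp

theorem integrable_comp_sum_range {E Ω : Type*} [NormedAddCommGroup E] [MeasurableSpace E]
    [BorelSpace E] [SecondCountableTopology E] [MeasurableSpace Ω] {μ : Measure Ω}
    [IsProbabilityMeasure μ] {X : ℕ → Ω → E} {R : ℝ} {F : Type*} [NormedAddCommGroup F] [MeasurableSpace F]
    [BorelSpace F] [SecondCountableTopology F]
    (hm : ∀ i, AEMeasurable (X i) μ)
    (hb : ∀ i, ∀ᵐ ω ∂μ, ‖X i ω‖ ≤ R) (n : ℕ) {φ : E → F} (hφ : Measurable φ)
    {ψ : ℝ → ℝ} (hψ : MonotoneOn ψ (Set.Ici 0)) (hle : ∀ x, ‖φ x‖ ≤ ψ ‖x‖) :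
    Integrable (fun ω => φ (∑ i ∈ Finset.range n, X i ω)) μ := by
  refine Integrable.of_bound
    (hφ.comp_aemeasurable (by fun_prop)).aestronglyMeasurable (ψ (n * R)) ?_
  filter_upwards [ae_norm_sum_range_le hb n] with ω h
  exact (hle _).trans (hψ (norm_nonneg _) ((norm_nonneg _).trans h) h)

section Hilbert

variable {E : Type*} [NormedAddCommGroup E] [InnerProductSpace ℝ E]

/-- Apply the chord inequality with `q = R` and `θ` the inner product divided by `‖x‖ R`. The point
is that the error term is linear in `y`, so it averages to zero when `y` is centred and independent
of `x`. -/
theorem cosh_norm_add_le {x y : E} {R : ℝ} (hR : 0 < R) (hy : ‖y‖ ≤ R) :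
    Real.cosh ‖x + y‖ ≤ Real.cosh ‖x‖ * Real.cosh R +
      inner ℝ ((Real.sinh ‖x‖ * Real.sinh R / (‖x‖ * R)) • x) y := by
  have hin := abs_real_inner_le_norm x y
  have hle : |inner ℝ x y| ≤ ‖x‖ * R := hin.trans (by gcongr)
  set θ : ℝ := inner ℝ x y / (‖x‖ * R) with hθ
  have hab : |θ| ≤ 1 := by
    rw [hθ, abs_div, abs_of_nonneg (by positivity : 0 ≤ ‖x‖ * R)]
    exact div_le_one_of_le₀ hle (by positivity)
  have hmul : ‖x‖ * R * θ = inner ℝ x y := by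
    rcases eq_or_ne (‖x‖) 0 with h | h
    · have : x = 0 := norm_eq_zero.1 h
      simp [this]
    · rw [hθ]; field_simp
  have hch := cosh_sqrt_chord (norm_nonneg x) hR.le (abs_le.1 hab).1 (abs_le.1 hab).2
  have h1 : ‖x + y‖ ≤ √(‖x‖ ^ 2 + R ^ 2 + 2 * (‖x‖ * R * θ)) := by
    apply Real.le_sqrt_of_sq_le
    rw [norm_add_sq_real, hmul]
    have : ‖y‖ ^ 2 ≤ R ^ 2 := by gcongr
    linarith
  have h2 : Real.cosh ‖x + y‖ ≤ Real.cosh √(‖x‖ ^ 2 + R ^ 2 + 2 * (‖x‖ * R * θ)) := by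
    rw [Real.cosh_le_cosh, abs_of_nonneg (norm_nonneg _), abs_of_nonneg (Real.sqrt_nonneg _)]
    exact h1
  refine h2.trans (hch.trans (le_of_eq ?_))
  rw [real_inner_smul_left, hθ]
  ring

variable [CompleteSpace E] [MeasurableSpace E] [BorelSpace E] [SecondCountableTopology E]
  {Ω : Type*} [MeasurableSpace Ω] {μ : Measure Ω} [IsProbabilityMeasure μ]
  {X : ℕ → Ω → E} {R : ℝ}

/-- The next centred summand is independent of the past sum, so the pairing factors through its zero
mean. This removes the cross term in both moment inductions below. -/
theorem integral_inner_comp_sum_range (hind : iIndepFun X μ) (hm : ∀ i, AEMeasurable (X i) μ)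
    (hb : ∀ i, ∀ᵐ ω ∂μ, ‖X i ω‖ ≤ R) (hz : ∀ i, ∫ ω, X i ω ∂μ = 0) (n : ℕ)
    {φ : E → E} (hφ : Measurable φ)
    (hi : Integrable (fun ω => φ (∑ i ∈ Finset.range n, X i ω)) μ) :
    Integrable (fun ω => (inner ℝ (φ (∑ i ∈ Finset.range n, X i ω)) (X n ω) : ℝ)) μ ∧
    ∫ ω, (inner ℝ (φ (∑ i ∈ Finset.range n, X i ω)) (X n ω) : ℝ) ∂μ = 0 := by
  have hXi : Integrable (X n) μ := Integrable.of_bound (hm n).aestronglyMeasurable R (hb n)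
  have h1 : IndepFun (fun ω => ∑ i ∈ Finset.range n, X i ω) (X n) μ := by
    have := hind.indepFun_finsetSum_of_notMem₀ hm (s := Finset.range n) (i := n) (by simp)
    convert this using 1
    ext ω; simp
  have h2 : IndepFun (fun ω => φ (∑ i ∈ Finset.range n, X i ω)) (X n) μ :=
    h1.comp hφ measurable_id
  refine ⟨h2.integrable_bilin hi hXi (innerSL ℝ), ?_⟩
  have := h2.integral_bilin hi hXi (innerSL ℝ)
  rw [hz n] at this
  rw [map_zero] at this
  exact this

theorem integral_cosh_norm_sum_le (hind : iIndepFun X μ) (hm : ∀ i, AEMeasurable (X i) μ)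
    (hR : 0 < R) (hb : ∀ i, ∀ᵐ ω ∂μ, ‖X i ω‖ ≤ R) (hz : ∀ i, ∫ ω, X i ω ∂μ = 0) (n : ℕ) :
    ∫ ω, Real.cosh ‖∑ i ∈ Finset.range n, X i ω‖ ∂μ ≤ Real.cosh R ^ n := by
  have hmono : MonotoneOn Real.cosh (Set.Ici 0) := fun x hx y hy hxy => by
    rwa [Real.cosh_le_cosh, abs_of_nonneg hx, abs_of_nonneg hy]
  have hcm : Measurable fun x : E => Real.cosh ‖x‖ := by fun_prop
  have hint : ∀ n, Integrable (fun ω => Real.cosh ‖∑ i ∈ Finset.range n, X i ω‖) μ := fun n =>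
    integrable_comp_sum_range hm hb n hcm hmono
      (fun x => by rw [Real.norm_of_nonneg (Real.cosh_pos _).le])
  induction n with
  | zero => simp
  | succ n ih =>
    set φ : E → E := fun x => (Real.sinh ‖x‖ * Real.sinh R / (‖x‖ * R)) • x with hφ
    have hφm : Measurable φ := by fun_prop
    have hs : 0 ≤ Real.sinh R := Real.sinh_nonneg_iff.2 hR.le
    have hφi : Integrable (fun ω => φ (∑ i ∈ Finset.range n, X i ω)) μ := by
      refine integrable_comp_sum_range hm hb n hφm
        (ψ := fun t => Real.sinh t * Real.sinh R / R)
        (fun x hx y hy hxy => ?_) fun x => ?_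
      · have := Real.sinh_le_sinh.2 hxy
        simp only; gcongr
      · have hx : 0 ≤ Real.sinh ‖x‖ := Real.sinh_nonneg_iff.2 (norm_nonneg x)
        rw [hφ, norm_smul, Real.norm_of_nonneg (by positivity)]
        rcases eq_or_ne (‖x‖) 0 with h | h
        · simp [h]
        · apply le_of_eq; field_simp
    obtain ⟨hi1, hi2⟩ := integral_inner_comp_sum_range hind hm hb hz n hφm hφi
    calc _ ≤ ∫ ω, (Real.cosh ‖∑ i ∈ Finset.range n, X i ω‖ * Real.cosh R +
          inner ℝ (φ (∑ i ∈ Finset.range n, X i ω)) (X n ω)) ∂μ := by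
          refine integral_mono_ae (hint _) (((hint n).mul_const _).add hi1) ?_
          filter_upwards [hb n] with ω h
          rw [Finset.sum_range_succ]
          exact cosh_norm_add_le hR h
      _ = (∫ ω, Real.cosh ‖∑ i ∈ Finset.range n, X i ω‖ ∂μ) * Real.cosh R := by
          rw [integral_add ((hint n).mul_const _) hi1, hi2, integral_mul_const, add_zero]
      _ ≤ _ := by
          rw [pow_succ]
          exact mul_le_mul_of_nonneg_right ih (Real.cosh_pos _).le

theorem integral_norm_sum_sq_le (hind : iIndepFun X μ) (hm : ∀ i, AEMeasurable (X i) μ)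
    (hb : ∀ i, ∀ᵐ ω ∂μ, ‖X i ω‖ ≤ R) (hz : ∀ i, ∫ ω, X i ω ∂μ = 0) (n : ℕ) :
    ∫ ω, ‖∑ i ∈ Finset.range n, X i ω‖ ^ 2 ∂μ ≤ n * R ^ 2 := by
  have hint : ∀ n, Integrable (fun ω => ‖∑ i ∈ Finset.range n, X i ω‖ ^ 2) μ := fun n =>
    integrable_comp_sum_range hm hb n (φ := fun x => ‖x‖ ^ 2) (by fun_prop)
      (ψ := fun t => t ^ 2) (fun x hx y hy hxy => pow_le_pow_left₀ hx hxy 2)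
      (fun x => by rw [Real.norm_of_nonneg (by positivity)])
  induction n with
  | zero => simp
  | succ n ih =>
    obtain ⟨hi1, hi2⟩ := integral_inner_comp_sum_range hind hm hb hz n (φ := fun x => (2 : ℝ) • x)
      (by fun_prop) (integrable_comp_sum_range hm hb n (by fun_prop) (ψ := fun t => 2 * t)
        (fun x _ y _ hxy => by simpa using hxy) (fun x => by simp [norm_smul]))
    calc _ ≤ ∫ ω, ((‖∑ i ∈ Finset.range n, X i ω‖ ^ 2 +
          inner ℝ ((2 : ℝ) • (∑ i ∈ Finset.range n, X i ω)) (X n ω)) + R ^ 2) ∂μ := by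
          refine integral_mono_ae (hint _) (((hint n).add hi1).add (integrable_const _)) ?_
          filter_upwards [hb n] with ω h
          rw [Finset.sum_range_succ, norm_add_sq_real, real_inner_smul_left]
          have : ‖X n ω‖ ^ 2 ≤ R ^ 2 := by gcongr
          linarith
      _ = (∫ ω, ‖∑ i ∈ Finset.range n, X i ω‖ ^ 2 ∂μ) + R ^ 2 := by
          rw [integral_add (by exact (hint n).add hi1) (integrable_const _),
            integral_add (hint n) hi1, hi2]
          simp
      _ ≤ _ := by push_cast; linarith

/-- A Hilbert space valued Hoeffding bound for the normalised sum: its hyperbolic moments are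
sub-Gaussian, with no dependence on the dimension. -/
theorem integral_cosh_mul_norm_normalized_sum_le (hind : iIndepFun X μ)
    (hm : ∀ i, AEMeasurable (X i) μ)
    (hR : 0 < R) (hb : ∀ i, ∀ᵐ ω ∂μ, ‖X i ω‖ ≤ R) (hz : ∀ i, ∫ ω, X i ω ∂μ = 0)
    {n : ℕ} (hn : 0 < n) {t : ℝ} (ht : 0 < t) :
    Integrable (fun ω => Real.cosh (t * ‖(√n)⁻¹ • ∑ i ∈ Finset.range n, X i ω‖)) μ ∧
    ∫ ω, Real.cosh (t * ‖(√n)⁻¹ • ∑ i ∈ Finset.range n, X i ω‖) ∂μ ≤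
      Real.exp (t ^ 2 * R ^ 2 / 2) := by
  have hn' : (0 : ℝ) < n := by exact_mod_cast hn
  have hsn : 0 < √(n : ℝ) := Real.sqrt_pos.2 hn'
  set c : ℝ := t * (√n)⁻¹ with hc
  have hc0 : 0 < c := by positivity
  have heq : ∀ ω, t * ‖(√n)⁻¹ • ∑ i ∈ Finset.range n, X i ω‖ =
      ‖∑ i ∈ Finset.range n, c • X i ω‖ := fun ω => by
    rw [← Finset.smul_sum, norm_smul, norm_smul, Real.norm_of_nonneg hc0.le,
      Real.norm_of_nonneg (by positivity), hc]
    ring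
  simp_rw [heq]
  have hind' : iIndepFun (fun i ω => c • X i ω) μ :=
    hind.comp (fun _ x => c • x) (fun _ => by fun_prop)
  have hb' : ∀ i, ∀ᵐ ω ∂μ, ‖c • X i ω‖ ≤ c * R := fun i => by
    filter_upwards [hb i] with ω h
    rw [norm_smul, Real.norm_of_nonneg hc0.le]
    gcongr
  have hm' : ∀ i, AEMeasurable (fun ω => c • X i ω) μ := fun i => (hm i).const_smul c
  refine ⟨integrable_comp_sum_range hm' hb' n (φ := fun x => Real.cosh ‖x‖) (by fun_prop)
    (ψ := Real.cosh) (fun x hx y hy hxy => ?_)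
    (fun x => by rw [Real.norm_of_nonneg (Real.cosh_pos _).le]), ?_⟩
  · rwa [Real.cosh_le_cosh, abs_of_nonneg hx, abs_of_nonneg hy]
  refine (integral_cosh_norm_sum_le hind' hm' (by positivity : 0 < c * R) hb'
    (fun i => by rw [integral_smul, hz i, smul_zero]) n).trans ?_
  calc _ ≤ Real.exp ((c * R) ^ 2 / 2) ^ n := by
        gcongr
        exact Real.cosh_le_exp_half_sq _
    _ = _ := by
        rw [← Real.exp_nat_mul]
        congr 1
        rw [hc, mul_pow, mul_pow, inv_pow, Real.sq_sqrt hn'.le]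
        field_simp

theorem integral_norm_normalized_sum_le (hind : iIndepFun X μ)
    (hm : ∀ i, AEMeasurable (X i) μ)
    (hR : 0 ≤ R) (hb : ∀ i, ∀ᵐ ω ∂μ, ‖X i ω‖ ≤ R) (hz : ∀ i, ∫ ω, X i ω ∂μ = 0)
    {n : ℕ} (hn : 0 < n) :
    Integrable (fun ω => ‖(√n)⁻¹ • ∑ i ∈ Finset.range n, X i ω‖) μ ∧
    ∫ ω, ‖(√n)⁻¹ • ∑ i ∈ Finset.range n, X i ω‖ ∂μ ≤ R := by
  have hn' : (0 : ℝ) < n := by exact_mod_cast hn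
  have hsn : 0 < √(n : ℝ) := Real.sqrt_pos.2 hn'
  simp_rw [norm_smul]
  have h1 : Integrable (fun ω => ‖∑ i ∈ Finset.range n, X i ω‖) μ :=
    integrable_comp_sum_range hm hb n (φ := fun x => ‖x‖) (by fun_prop) (ψ := fun t => t)
      (fun x _ y _ h => h) (fun x => by simp)
  have h2 : Integrable (fun ω => ‖∑ i ∈ Finset.range n, X i ω‖ ^ 2) μ :=
    integrable_comp_sum_range hm hb n (φ := fun x => ‖x‖ ^ 2) (by fun_prop)
      (ψ := fun t => t ^ 2) (fun x hx y hy hxy => pow_le_pow_left₀ hx hxy 2)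
      (fun x => by rw [Real.norm_of_nonneg (by positivity)])
  refine ⟨h1.const_mul _, ?_⟩
  rw [integral_const_mul, Real.norm_of_nonneg (by positivity), inv_mul_le_iff₀ hsn]
  set e := ∫ ω, ‖∑ i ∈ Finset.range n, X i ω‖ ∂μ with he
  have hsq : e ^ 2 ≤ n * R ^ 2 := by
    refine le_trans ?_ (integral_norm_sum_sq_le hind hm hb hz n)
    -- Nonnegativity of the variance: the squared mean is at most the second moment.
    have h0 : 0 ≤ ∫ ω, (‖∑ i ∈ Finset.range n, X i ω‖ - e) ^ 2 ∂μ :=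
      integral_nonneg fun ω => sq_nonneg _
    have heq : ∀ ω, (‖∑ i ∈ Finset.range n, X i ω‖ - e) ^ 2 =
        (‖∑ i ∈ Finset.range n, X i ω‖ ^ 2 - 2 * e * ‖∑ i ∈ Finset.range n, X i ω‖) + e ^ 2 :=
      fun ω => by ring
    simp_rw [heq] at h0
    rw [integral_add (by exact h2.sub (h1.const_mul (2 * e))) (integrable_const _),
      integral_sub h2 (h1.const_mul _), integral_const_mul, ← he] at h0
    simp at h0
    linarith
  refine (abs_le_of_sq_le_sq' ?_ (by positivity)).2
  rw [mul_pow, Real.sq_sqrt hn'.le]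
  exact hsq

end Hilbert

/-! ### Series of nonnegative random variables. -/

section Series

variable {Ω : Type*} [MeasurableSpace Ω] {μ : Measure Ω}

/-- A series of nonnegative functions whose partial integrals are bounded converges almost
everywhere to an integrable function. -/
theorem summable_integrable_tsum_of_sum_integral_le {f : ℕ → Ω → ℝ} {B : ℝ}
    (h0 : ∀ n ω, 0 ≤ f n ω) (hi : ∀ n, Integrable (f n) μ)
    (hB : ∀ N, ∑ n ∈ Finset.range N, ∫ ω, f n ω ∂μ ≤ B) :
    (∀ᵐ ω ∂μ, Summable fun n => f n ω) ∧ Integrable (fun ω => ∑' n, f n ω) μ ∧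
      ∫ ω, ∑' n, f n ω ∂μ ≤ B := by
  have hs : Summable fun n => ∫ ω, f n ω ∂μ :=
    summable_of_sum_range_le (fun n => integral_nonneg (h0 n)) hB
  have hn : ∀ n ω, ‖f n ω‖ = f n ω := fun n ω => Real.norm_of_nonneg (h0 n ω)
  have hlin : ∀ n, ∫⁻ ω, ENNReal.ofReal (f n ω) ∂μ = ENNReal.ofReal (∫ ω, f n ω ∂μ) := fun n =>
    (ofReal_integral_eq_lintegral_ofReal (hi n) (Filter.Eventually.of_forall (h0 n))).symm
  have hfin : ∫⁻ ω, ∑' n, ENNReal.ofReal (f n ω) ∂μ ≠ ⊤ := by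
    rw [lintegral_tsum fun n => (hi n).aemeasurable.ennreal_ofReal]
    simp_rw [hlin]
    exact hs.tsum_ofReal_ne_top
  have hae : ∀ᵐ ω ∂μ, Summable fun n => f n ω := by
    filter_upwards [ae_lt_top' (AEMeasurable.tsum
      fun n => (hi n).aemeasurable.ennreal_ofReal) hfin] with ω hω
    have := ENNReal.summable_toReal hω.ne
    simpa only [ENNReal.toReal_ofReal (h0 _ ω)] using this
  have heq : ∀ᵐ ω ∂μ, (∑' n, ENNReal.ofReal (f n ω)).toReal = ∑' n, f n ω := by
    filter_upwards [hae] with ω hω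
    rw [← ENNReal.ofReal_tsum_of_nonneg (fun n => h0 n ω) hω,
      ENNReal.toReal_ofReal (tsum_nonneg fun n => h0 n ω)]
  refine ⟨hae, ?_, ?_⟩
  · exact (integrable_toReal_of_lintegral_ne_top (AEMeasurable.tsum
      fun n => (hi n).aemeasurable.ennreal_ofReal) hfin).congr heq
  · rw [← integral_tsum_of_summable_integral_norm hi (by simpa only [hn] using hs)]
    exact Real.tsum_le_of_sum_range_le (fun n => integral_nonneg (h0 n)) hB

end Series

/-! ### Tail expectations and their summation over the rounds. -/

section Tail

variable {Ω : Type*} [MeasurableSpace Ω] {μ : Measure Ω}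

/-- Tail bound for a shifted random variable that is sub-Gaussian in the sense of hyperbolic
moments. -/
theorem integral_le_of_cosh_moment {f w : Ω → ℝ} {m R s : ℝ} (hR : 0 < R) (hm : 0 ≤ m)
    (hf : Integrable f μ) (hs : m + R ≤ s)
    (hcosh : ∀ t : ℝ, 0 < t → Integrable (fun ω => Real.cosh (t * w ω)) μ ∧
      ∫ ω, Real.cosh (t * w ω) ∂μ ≤ Real.exp (t ^ 2 * R ^ 2 / 2))
    (hle : ∀ ω, f ω ≤ m + w ω) (hz : ∀ ω, m + w ω < s → f ω ≤ 0) :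
    ∫ ω, f ω ∂μ ≤ 2 * s * Real.exp (-((s - m) ^ 2 / (2 * R ^ 2))) := by
  set u := s - m with hu
  have huR : R ≤ u := by linarith
  have hu0 : 0 < u := hR.trans_le huR
  have hs0 : 0 < s := by linarith
  -- The Chernoff-optimal parameter: it minimises `l² R² / 2 - l u`.
  set l := u / R ^ 2 with hl
  have hl0 : 0 < l := by positivity
  have hsl : 1 ≤ s * l := by
    rw [hl, mul_div_assoc', one_le_div (by positivity)]
    nlinarith
  obtain ⟨hci, hcb⟩ := hcosh l hl0
  have hpt : ∀ ω, f ω ≤ 2 * s * Real.exp (-(l * u)) * Real.cosh (l * w ω) := fun ω => by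
    rcases lt_or_ge (m + w ω) s with h | h
    · exact (hz ω h).trans (by have := Real.cosh_pos (l * w ω); positivity)
    -- On the event that remains `w - u ≥ 0`, and `s l ≥ 1`, so the line of slope one through height
    -- `s` lies below `s (1 + l (w - u))`, hence below the exponential.
    · have h1 : m + w ω ≤ s * Real.exp (l * (w ω - u)) := by
        have := Real.add_one_le_exp (l * (w ω - u))
        calc m + w ω = s + 1 * (w ω - u) := by rw [hu]; ring
          _ ≤ s + s * l * (w ω - u) := by
            gcongr
            linarith
          _ = s * (l * (w ω - u) + 1) := by ring
          _ ≤ _ := by gcongr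
      have h2 : Real.exp (l * w ω) ≤ 2 * Real.cosh (l * w ω) := by
        rw [Real.cosh_eq]
        have := Real.exp_pos (-(l * w ω))
        linarith
      calc f ω ≤ s * Real.exp (l * (w ω - u)) := (hle ω).trans h1
        _ = s * Real.exp (-(l * u)) * Real.exp (l * w ω) := by
          rw [mul_assoc, ← Real.exp_add]; congr 2; ring
        _ ≤ s * Real.exp (-(l * u)) * (2 * Real.cosh (l * w ω)) := by gcongr
        _ = _ := by ring
  calc ∫ ω, f ω ∂μ ≤ ∫ ω, 2 * s * Real.exp (-(l * u)) * Real.cosh (l * w ω) ∂μ :=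
        integral_mono hf (hci.const_mul _) hpt
    _ ≤ 2 * s * Real.exp (-(l * u)) * Real.exp (l ^ 2 * R ^ 2 / 2) := by
        rw [integral_const_mul]; gcongr
    _ = _ := by
        rw [mul_assoc, ← Real.exp_add]
        congr 2
        rw [hl]; field_simp; ring

/-- This compares a right-endpoint rectangle with the integral of `u exp(-u² / (2R²))`, which
decreases on `[R, ∞)`. With `x = (u² - v²) / (2R²)`, the linear term of `exp x` gives `(u - v)(u +
v) / 2`; the missing `(u - v)² / 2` comes from the quadratic term, because `u + v ≥ 2R`. -/
theorem mul_exp_neg_sq_le_sub {R u v : ℝ} (hR : 0 < R) (hv : R ≤ v) (huv : v ≤ u) :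
    (u - v) * (u * Real.exp (-(u ^ 2 / (2 * R ^ 2)))) ≤
      R ^ 2 * (Real.exp (-(v ^ 2 / (2 * R ^ 2))) - Real.exp (-(u ^ 2 / (2 * R ^ 2)))) := by
  set x := (u ^ 2 - v ^ 2) / (2 * R ^ 2) with hx
  have hx0 : 0 ≤ x := by
    apply div_nonneg _ (by positivity)
    nlinarith
  have he : Real.exp (-(v ^ 2 / (2 * R ^ 2))) =
      Real.exp (-(u ^ 2 / (2 * R ^ 2))) * Real.exp x := by
    rw [← Real.exp_add]; congr 1; rw [hx]; ring
  have hq := Real.quadratic_le_exp_of_nonneg hx0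
  have hkey : (u - v) * u ≤ R ^ 2 * (x + x ^ 2 / 2) := by
    have h1 : R ^ 2 * x = (u - v) * (u + v) / 2 := by rw [hx]; field_simp; ring
    have h2 : (u + v) / 2 * (u - v) * 1 ≤ x * R ^ 2 := by rw [mul_comm x, h1]; linarith
    have h3 : u - v ≤ x * R := by
      have : (u - v) * R ≤ x * R * R := by nlinarith
      exact le_of_mul_le_mul_right this hR
    have h4 : (u - v) ^ 2 ≤ (x * R) ^ 2 := pow_le_pow_left₀ (by linarith) h3 2
    nlinarith
  rw [he]
  have hE := Real.exp_pos (-(u ^ 2 / (2 * R ^ 2)))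
  calc _ = Real.exp (-(u ^ 2 / (2 * R ^ 2))) * ((u - v) * u) := by ring
    _ ≤ Real.exp (-(u ^ 2 / (2 * R ^ 2))) * (R ^ 2 * (Real.exp x - 1)) := by
      refine mul_le_mul_of_nonneg_left (hkey.trans ?_) hE.le
      exact mul_le_mul_of_nonneg_left (by linarith) (sq_nonneg R)
    _ = _ := by ring

/-- An antiderivative of the decreasing envelope of the tail expectations: it is linear with slope
`m + R` up to `m + 3 R / 2` and has a Gaussian tail afterwards. -/
noncomputable def tailPrimitive (m R s : ℝ) : ℝ :=
  if s ≤ m + 3 / 2 * R then (m + R) * s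
  else (m + R) * (m + 3 / 2 * R) + 2 * (m / (3 / 2 * R) + 1) *
    (R ^ 2 * (Real.exp (-((3 / 2 * R) ^ 2 / (2 * R ^ 2))) -
      Real.exp (-((s - m) ^ 2 / (2 * R ^ 2)))))

/-- The rectangle bound that telescopes in the sum over rounds. At distance `3R/2` past `m` the
Gaussian bound has just become smaller than `m + R`, which is why the envelope switches there. -/
theorem mul_sub_le_tailPrimitive_sub {m R s t h : ℝ} (hR : 0 < R) (hm : 0 ≤ m) (hst : s ≤ t)
    (h1 : h ≤ m + R)
    (h2 : m + R ≤ t → h ≤ 2 * t * Real.exp (-((t - m) ^ 2 / (2 * R ^ 2)))) :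
    h * (t - s) ≤ tailPrimitive m R t - tailPrimitive m R s := by
  unfold tailPrimitive
  rcases le_or_gt t (m + 3 / 2 * R) with ht | ht
  · rw [if_pos ht, if_pos (hst.trans ht), ← mul_sub]
    exact mul_le_mul_of_nonneg_right h1 (by linarith)
  rw [if_neg ht.not_ge]
  -- Past the switch `t ≤ (m / (3R/2) + 1)(t - m)`, which replaces `t` by a multiple of `t - m` and
  -- gives an integrand with an explicit antiderivative.
  have hF : h ≤ 2 * (m / (3 / 2 * R) + 1) *
      ((t - m) * Real.exp (-((t - m) ^ 2 / (2 * R ^ 2)))) := by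
    refine (h2 (by linarith)).trans ?_
    rw [mul_assoc 2, mul_assoc 2, ← mul_assoc _ (t - m)]
    gcongr
    have : m ≤ m / (3 / 2 * R) * (t - m) := by
      rw [div_mul_eq_mul_div, le_div_iff₀ (by positivity)]
      exact mul_le_mul_of_nonneg_left (by linarith) hm
    linarith
  have hc : 0 ≤ 2 * (m / (3 / 2 * R) + 1) := by positivity
  rcases le_or_gt s (m + 3 / 2 * R) with hs | hs
  · rw [if_pos hs]
    -- The interval straddles the switch: the constant bound is used before it, the Gaussian bound
    -- after it.
    have e1 := mul_exp_neg_sq_le_sub (u := t - m) (v := 3 / 2 * R) hR (by linarith) (by linarith)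
    have e2 := mul_le_mul_of_nonneg_left e1 hc
    have e3 := mul_le_mul_of_nonneg_right hF (by linarith : 0 ≤ t - m - 3 / 2 * R)
    have e4 := mul_le_mul_of_nonneg_right h1 (by linarith : 0 ≤ m + 3 / 2 * R - s)
    linarith
  · rw [if_neg hs.not_ge]
    have e1 := mul_exp_neg_sq_le_sub (u := t - m) (v := s - m) hR (by linarith) (by linarith)
    have e2 := mul_le_mul_of_nonneg_left e1 hc
    have e3 := mul_le_mul_of_nonneg_right hF (by linarith : 0 ≤ t - m - (s - m))
    linarith

theorem exp_neg_nine_div_eight_le : Real.exp (-(9 / 8 : ℝ)) ≤ 13 / 40 := by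
  rw [Real.exp_neg, inv_le_comm₀ (Real.exp_pos _) (by norm_num)]
  have h := Real.sum_le_exp_of_nonneg (x := (9 / 8 : ℝ)) (by norm_num) 8
  refine le_trans ?_ h
  norm_num [Finset.sum_range_succ, Nat.factorial]

theorem tailPrimitive_le {m R s : ℝ} (hR : 0 < R) (hm : 0 ≤ m) :
    tailPrimitive m R s ≤ m ^ 2 + 44 / 15 * (m * R) + 43 / 20 * R ^ 2 := by
  have he : Real.exp (-((3 / 2 * R) ^ 2 / (2 * R ^ 2))) ≤ 13 / 40 := by
    refine le_trans (le_of_eq ?_) exp_neg_nine_div_eight_le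
    congr 1; field_simp; norm_num
  have hmR := mul_nonneg hm hR.le
  unfold tailPrimitive
  split_ifs with hs
  · have := mul_le_mul_of_nonneg_left hs (by positivity : 0 ≤ m + R)
    nlinarith [sq_nonneg R]
  · have hx := Real.exp_pos (-((s - m) ^ 2 / (2 * R ^ 2)))
    calc _ ≤ (m + R) * (m + 3 / 2 * R) + 2 * (m / (3 / 2 * R) + 1) * (R ^ 2 * (13 / 40)) := by
          gcongr
          linarith
      _ = _ := by field_simp; ring

theorem one_div_sqrt_le {n : ℕ} : (√((n : ℝ) + 1))⁻¹ ≤ 2 * (√((n : ℝ) + 1) - √n) := by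
  have h1 : 0 < √((n : ℝ) + 1) := Real.sqrt_pos.2 (by positivity)
  have h2 : √(n : ℝ) ≤ √((n : ℝ) + 1) := Real.sqrt_le_sqrt (by linarith)
  have h3 := Real.sq_sqrt (by positivity : (0 : ℝ) ≤ n + 1)
  have h4 := Real.sq_sqrt (by positivity : (0 : ℝ) ≤ n)
  rw [inv_le_iff_one_le_mul₀ h1]
  nlinarith [Real.sqrt_nonneg (n : ℝ)]

/-- A sum of nonnegative random variables, each controlled by a sub-Gaussian variable and vanishing
below a threshold, has finite expectation. -/
theorem summable_integrable_tsum_of_threshold [IsProbabilityMeasure μ] {f : ℕ → Ω → ℝ} {w : ℕ → Ω → ℝ}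
    {m R D δ A : ℝ} (hR : 0 < R) (hm : 0 ≤ m) (hD : 0 < D) (hδ : 0 < δ)
    (h0 : ∀ n ω, 0 ≤ f n ω) (hmeas : ∀ n, AEStronglyMeasurable (f n) μ)
    (hA : ∀ ω, f 0 ω ≤ A)
    (hw : ∀ n, 0 < n → Integrable (w n) μ ∧ ∫ ω, w n ω ∂μ ≤ R)
    (hcosh : ∀ n, 0 < n → ∀ t : ℝ, 0 < t → Integrable (fun ω => Real.cosh (t * w n ω)) μ ∧
      ∫ ω, Real.cosh (t * w n ω) ∂μ ≤ Real.exp (t ^ 2 * R ^ 2 / 2))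
    (hle : ∀ n, 0 < n → ∀ ω, f n ω * √n ≤ (m + w n ω) * D)
    (hz : ∀ n, 0 < n → ∀ ω, (m + w n ω) * D < δ * √n → f n ω = 0) :
    (∀ᵐ ω ∂μ, Summable fun n => f n ω) ∧ Integrable (fun ω => ∑' n, f n ω) μ ∧
      ∫ ω, ∑' n, f n ω ∂μ ≤
        A + D ^ 2 / δ * (2 * m ^ 2 + 88 / 15 * (m * R) + 43 / 10 * R ^ 2) := by
  have hi : ∀ n, Integrable (f n) μ := fun n => by
    rcases Nat.eq_zero_or_pos n with rfl | hn
    · refine Integrable.of_bound (hmeas 0) A (Filter.Eventually.of_forall fun ω => ?_)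
      rw [Real.norm_of_nonneg (h0 0 ω)]
      exact hA ω
    · have hsn : 0 < √(n : ℝ) := Real.sqrt_pos.2 (by exact_mod_cast hn)
      refine Integrable.mono' ((((integrable_const m).add (hw n hn).1).mul_const D).div_const √n)
        (hmeas n) (Filter.Eventually.of_forall fun ω => ?_)
      rw [Real.norm_of_nonneg (h0 n ω)]
      exact (le_div_iff₀ hsn).2 (hle n hn ω)
  set σ := δ / D with hσ
  have hσ0 : 0 < σ := by positivity
  have hstep : ∀ n : ℕ, ∫ ω, f (n + 1) ω ∂μ ≤
      2 * D ^ 2 / δ * (tailPrimitive m R (σ * √((n + 1 : ℕ) : ℝ)) -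
        tailPrimitive m R (σ * √(n : ℝ))) := fun n => by
    have hsn : 0 < √((n + 1 : ℕ) : ℝ) := Real.sqrt_pos.2 (by positivity)
    -- In this scaling `g ≤ m + w`, and `g` vanishes when `m + w` is below `σ√(n+1)`.
    set g : Ω → ℝ := fun ω => √((n + 1 : ℕ) : ℝ) / D * f (n + 1) ω with hg
    have hgi : Integrable g μ := (hi _).const_mul _
    have hgle : ∀ ω, g ω ≤ m + w (n + 1) ω := fun ω => by
      have := hle (n + 1) n.succ_pos ω
      rw [hg]
      simp only
      rw [div_mul_eq_mul_div, div_le_iff₀ hD]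
      linarith
    have hg1 : ∫ ω, g ω ∂μ ≤ m + R := by
      refine (integral_mono hgi ((integrable_const m).add (hw _ n.succ_pos).1) hgle).trans ?_
      have := (hw _ n.succ_pos).2
      rw [Pi.add_def, integral_add (integrable_const m) (hw _ n.succ_pos).1]
      simpa using this
    have hg2 : m + R ≤ σ * √((n + 1 : ℕ) : ℝ) → ∫ ω, g ω ∂μ ≤ 2 * (σ * √((n + 1 : ℕ) : ℝ)) *
        Real.exp (-((σ * √((n + 1 : ℕ) : ℝ) - m) ^ 2 / (2 * R ^ 2))) := fun h => by
      refine integral_le_of_cosh_moment hR hm hgi h (hcosh _ n.succ_pos) hgle fun ω hω => ?_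
      have : f (n + 1) ω = 0 := by
        refine hz _ n.succ_pos ω ?_
        rw [hσ, div_mul_eq_mul_div, lt_div_iff₀ hD] at hω
        exact hω
      rw [hg]
      simp [this]
    have hst : σ * √(n : ℝ) ≤ σ * √((n + 1 : ℕ) : ℝ) := by
      gcongr; exact_mod_cast n.le_succ
    have hkey := mul_sub_le_tailPrimitive_sub hR hm hst hg1 hg2
    have hg0 : 0 ≤ ∫ ω, g ω ∂μ := integral_nonneg fun ω => mul_nonneg (by positivity) (h0 _ ω)
    have hfg : ∫ ω, f (n + 1) ω ∂μ = D * (√((n + 1 : ℕ) : ℝ))⁻¹ * ∫ ω, g ω ∂μ := by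
      rw [hg, integral_const_mul]; field_simp
    -- The weight `1/√(n+1)` is at most twice the increment of the square root, so the sum becomes a
    -- Riemann sum in `s = σ√n`.
    have hinv : (√((n + 1 : ℕ) : ℝ))⁻¹ ≤ 2 * (√((n + 1 : ℕ) : ℝ) - √n) := by
      push_cast; exact one_div_sqrt_le
    calc _ = D * (√((n + 1 : ℕ) : ℝ))⁻¹ * ∫ ω, g ω ∂μ := hfg
      _ ≤ D * (2 * (√((n + 1 : ℕ) : ℝ) - √n)) * ∫ ω, g ω ∂μ := by gcongr
      _ = 2 * D ^ 2 / δ * ((∫ ω, g ω ∂μ) * (σ * √((n + 1 : ℕ) : ℝ) - σ * √n)) := by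
          rw [hσ]; field_simp
      _ ≤ _ := by gcongr
  refine summable_integrable_tsum_of_sum_integral_le h0 hi fun N => ?_
  have hfirst : ∫ ω, f 0 ω ∂μ ≤ A := by
    refine (integral_mono (hi 0) (integrable_const A) hA).trans ?_
    simp
  have hsum : ∀ N : ℕ, ∑ n ∈ Finset.range (N + 1), ∫ ω, f n ω ∂μ ≤
      A + 2 * D ^ 2 / δ * tailPrimitive m R (σ * √(N : ℝ)) := fun N => by
    induction N with
    | zero =>
      have : tailPrimitive m R 0 = 0 := by
        unfold tailPrimitive
        rw [if_pos (by positivity), mul_zero]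
      simpa [this] using hfirst
    | succ N ih =>
      rw [Finset.sum_range_succ]
      have := hstep N
      linarith
  calc ∑ n ∈ Finset.range N, ∫ ω, f n ω ∂μ ≤ ∑ n ∈ Finset.range (N + 1), ∫ ω, f n ω ∂μ :=
        Finset.sum_le_sum_of_subset_of_nonneg (by simp) fun n _ _ => integral_nonneg (h0 n)
    _ ≤ A + 2 * D ^ 2 / δ * tailPrimitive m R (σ * √(N : ℝ)) := hsum N
    _ ≤ A + 2 * D ^ 2 / δ * (m ^ 2 + 44 / 15 * (m * R) + 43 / 20 * R ^ 2) := by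
        gcongr; exact tailPrimitive_le hR hm
    _ = _ := by ring

end Tail

/-! ### Projection onto a polytope. -/

section Projection

variable {d : ℕ}

theorem IsNearestPoint.inner_le_zero {X : Set (EuclideanSpace ℝ (Fin d))} (hX : Convex ℝ X)
    {y p z : EuclideanSpace ℝ (Fin d)} (h : IsNearestPoint X y p) (hz : z ∈ X) :
    inner ℝ (y - p) (z - p) ≤ (0 : ℝ) := by
  refine (norm_eq_iInf_iff_real_inner_le_zero hX h.1).1 ?_ z hz
  have : Nonempty X := ⟨⟨p, h.1⟩⟩
  refine le_antisymm (le_ciInf fun w => ?_)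
    (ciInf_le ⟨0, by rintro _ ⟨w, rfl⟩; exact norm_nonneg _⟩ (⟨p, h.1⟩ : X))
  rw [norm_sub_rev y p, norm_sub_rev y w]
  exact h.2 w w.2

/-- The variational inequalities at the two projections add up to nonexpansiveness. Continuity is
needed for measurability of the actions. -/
theorem continuous_euclideanProj {X : Set (EuclideanSpace ℝ (Fin d))} (hX : Convex ℝ X)
    (hc : IsCompact X) (hne : X.Nonempty) : Continuous (euclideanProj X) := by
  refine (LipschitzWith.of_dist_le_mul (K := 1) fun y z => ?_).continuous
  have hy := euclideanProj_spec hc hne y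
  have hz := euclideanProj_spec hc hne z
  have h1 := hy.inner_le_zero hX hz.1
  have h2 := hz.inner_le_zero hX hy.1
  rw [dist_eq_norm, dist_eq_norm, NNReal.coe_one, one_mul]
  set p := euclideanProj X y
  set q := euclideanProj X z
  have h3 : ‖p - q‖ * ‖p - q‖ ≤ ‖y - z‖ * ‖p - q‖ := by
    refine le_trans ?_ (real_inner_le_norm (y - z) (p - q))
    rw [← real_inner_self_eq_norm_mul_norm]
    have e : (inner ℝ (y - z) (p - q) : ℝ) - inner ℝ (p - q) (p - q) =
        -(inner ℝ (y - p) (q - p) + inner ℝ (z - q) (p - q)) := by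
      simp only [inner_sub_left, inner_sub_right]
      ring
    linarith
  rcases (norm_nonneg (p - q)).eq_or_lt with h | h
  · rw [← h]; exact norm_nonneg _
  · exact le_of_mul_le_mul_right h3 h

/-- The vertices carrying the projection `p` of `e - c • a` onto a polytope maximise
`e - c • a - p`.  This bounds the suboptimality of `p`, and makes `p` optimal for large `c`. -/
theorem inner_sub_nearestPoint_le {V : Finset (EuclideanSpace ℝ (Fin d))}
    {a e p xstar : EuclideanSpace ℝ (Fin d)} {c B δ : ℝ}
    (hp : IsNearestPoint (convexHull ℝ (V : Set _)) (e - c • a) p)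
    (hx : xstar ∈ convexHull ℝ (V : Set (EuclideanSpace ℝ (Fin d))))
    (hc : 0 ≤ c) (hB : ∀ v ∈ V, inner ℝ (e - p) (v - xstar) ≤ B)
    (hδ : ∀ v ∈ V, inner ℝ a (v - xstar) = 0 ∨ δ ≤ inner ℝ a (v - xstar)) :
    inner ℝ a (p - xstar) * c ≤ B ∧ (B < δ * c → inner ℝ a (p - xstar) = 0) := by
  obtain ⟨l, hl0, hl1, hlp⟩ := Finset.mem_convexHull'.1 hp.1
  have hmax : ∀ z ∈ convexHull ℝ (V : Set (EuclideanSpace ℝ (Fin d))),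
      inner ℝ (e - c • a - p) (z - p) ≤ (0 : ℝ) :=
    fun z hz => hp.inner_le_zero (convex_convexHull ℝ _) hz
  have hsum : ∀ b z : EuclideanSpace ℝ (Fin d),
      ∑ v ∈ V, l v * inner ℝ b (v - z) = inner ℝ b (p - z) := fun b z => by
    simp only [inner_sub_right, mul_sub, Finset.sum_sub_distrib, ← Finset.sum_mul, hl1, one_mul,
      ← hlp, inner_sum, real_inner_smul_right]
  -- Complementary slackness: the terms are nonpositive and sum to the pairing with `p - p`, so each
  -- of them vanishes.
  have hzero : ∀ v ∈ V, l v * inner ℝ (e - c • a - p) (v - p) = 0 := by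
    refine (Finset.sum_eq_zero_iff_of_nonpos fun v hv => ?_).1 (by rw [hsum]; simp)
    exact mul_nonpos_of_nonneg_of_nonpos (hl0 v hv) (hmax v (subset_convexHull ℝ _ hv))
  have hv : ∀ v ∈ V, l v = 0 ∨ inner ℝ a (v - xstar) * c ≤ B := fun v hv => by
    refine (mul_eq_zero.1 (hzero v hv)).imp id fun h => ?_
    have h1 := hmax xstar hx
    have h2 := hB v hv
    have e1 : (inner ℝ (e - p) (v - xstar) : ℝ) - inner ℝ a (v - xstar) * c =
        inner ℝ (e - c • a - p) (v - p) - inner ℝ (e - c • a - p) (xstar - p) := by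
      simp only [inner_sub_left, inner_sub_right, real_inner_smul_left]
      ring
    linarith
  constructor
  · rw [← hsum, Finset.sum_mul]
    calc _ ≤ ∑ v ∈ V, l v * B := by
          refine Finset.sum_le_sum fun v hv' => ?_
          rcases hv v hv' with h | h
          · simp [h]
          · rw [mul_assoc]
            exact mul_le_mul_of_nonneg_left h (hl0 v hv')
      _ = B := by rw [← Finset.sum_mul, hl1, one_mul]
  · intro hlt
    rw [← hsum]
    refine Finset.sum_eq_zero fun v hv' => ?_
    rcases hv v hv' with h | h
    · simp [h]
    · rcases hδ v hv' with h' | h'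
      · simp [h']
      · exact absurd (mul_le_mul_of_nonneg_right h' hc) (by linarith)

end Projection

/-! ### Gaps between vertices. -/

section Gaps

variable {d : ℕ} {V : Finset (EuclideanSpace ℝ (Fin d))} {a : EuclideanSpace ℝ (Fin d)}

theorem vertexGaps_finite : (vertexGaps V a).Finite := by
  refine ((V.finite_toSet.prod V.finite_toSet).image
    fun q => (inner ℝ a (q.1 - q.2) : ℝ)).subset ?_
  rintro δ ⟨v, hv, w, hw, rfl⟩
  exact ⟨(v, w), ⟨hv, hw.1⟩, rfl⟩

theorem nonneg_of_mem_vertexGaps {δ : ℝ} (h : δ ∈ vertexGaps V a) : 0 ≤ δ := by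
  obtain ⟨v, hv, w, hw, rfl⟩ := h
  rw [inner_sub_right]
  linarith [hw.2 v hv]

theorem largestGap_nonneg : 0 ≤ largestGap V a :=
  Real.sSup_nonneg fun _ h => nonneg_of_mem_vertexGaps h

theorem exists_mem_optimalVertices (h : V.Nonempty) : ∃ w, w ∈ optimalVertices V a :=
  let ⟨w, hw, hmin⟩ := V.exists_min_image (fun v => (inner ℝ a v : ℝ)) h
  ⟨w, hw, hmin⟩

theorem inner_eq_of_mem_optimalVertices {w xstar : EuclideanSpace ℝ (Fin d)}
    (hw : w ∈ optimalVertices V a)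
    (hx : xstar ∈ convexHull ℝ (V : Set (EuclideanSpace ℝ (Fin d))))
    (hmin : ∀ z ∈ convexHull ℝ (V : Set (EuclideanSpace ℝ (Fin d))),
      (inner ℝ a xstar : ℝ) ≤ inner ℝ a z) : (inner ℝ a xstar : ℝ) = inner ℝ a w := by
  refine le_antisymm (hmin w (subset_convexHull ℝ _ hw.1)) ?_
  obtain ⟨l, hl0, hl1, rfl⟩ := Finset.mem_convexHull'.1 hx
  simp only [inner_sum, real_inner_smul_right]
  calc (inner ℝ a w : ℝ) = ∑ v ∈ V, l v * inner ℝ a w := by rw [← Finset.sum_mul, hl1, one_mul]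
    _ ≤ _ := Finset.sum_le_sum fun v hv => mul_le_mul_of_nonneg_left (hw.2 v hv) (hl0 v hv)

theorem suboptimalityGap_mem (hgap : ∃ v ∈ V, v ∉ optimalVertices V a) :
    suboptimalityGap V a ∈ {δ | δ ∈ vertexGaps V a ∧ 0 < δ} := by
  obtain ⟨v, hv, hnv⟩ := hgap
  obtain ⟨w, hw⟩ := exists_mem_optimalVertices (a := a) ⟨v, hv⟩
  refine Set.Nonempty.csInf_mem ⟨inner ℝ a (v - w), ⟨v, hv, w, hw, rfl⟩, ?_⟩
    (vertexGaps_finite.subset fun _ h => h.1)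
  rw [inner_sub_right, sub_pos]
  refine lt_of_le_of_ne (hw.2 v hv) fun h => hnv ⟨hv, fun z hz => ?_⟩
  rw [← h]
  exact hw.2 z hz

/-- The minimiser `xstar` need not be a vertex, but it has the same cost as an optimal vertex, so
its differences in cost with vertices are genuine gaps. -/
theorem gap_eq_zero_or_ge {v xstar : EuclideanSpace ℝ (Fin d)} (hv : v ∈ V)
    (hx : xstar ∈ convexHull ℝ (V : Set (EuclideanSpace ℝ (Fin d))))
    (hmin : ∀ z ∈ convexHull ℝ (V : Set (EuclideanSpace ℝ (Fin d))),
      (inner ℝ a xstar : ℝ) ≤ inner ℝ a z) :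
    inner ℝ a (v - xstar) = (0 : ℝ) ∨ suboptimalityGap V a ≤ inner ℝ a (v - xstar) := by
  obtain ⟨w, hw⟩ := exists_mem_optimalVertices (a := a) ⟨v, hv⟩
  have heq : (inner ℝ a (v - xstar) : ℝ) = inner ℝ a (v - w) := by
    rw [inner_sub_right, inner_sub_right, inner_eq_of_mem_optimalVertices hw hx hmin]
  have hmem : (inner ℝ a (v - xstar) : ℝ) ∈ vertexGaps V a := heq ▸ ⟨v, hv, w, hw, rfl⟩
  rcases (nonneg_of_mem_vertexGaps hmem).eq_or_lt with h | h
  · exact Or.inl h.symm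
  · exact Or.inr (csInf_le ⟨0, fun δ hδ => hδ.2.le⟩ ⟨hmem, h⟩)

end Gaps

/-! ### The regret bound with a quadratic form. -/

theorem norm_sub_le_maxDistTo {d : ℕ} {X : Set (EuclideanSpace ℝ (Fin d))} (hX : IsCompact X)
    {x : EuclideanSpace ℝ (Fin d)} (y : EuclideanSpace ℝ (Fin d)) (hx : x ∈ X) :
    ‖x - y‖ ≤ maxDistTo X y :=
  le_csSup (hX.image (f := fun x => ‖x - y‖) (by fun_prop)).bddAbove ⟨x, hx, rfl⟩

/-- The total pseudo-regret of the lazy anytime subgradient algorithm, with a bound in which `R`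
may be any positive bound for the noise. -/
theorem totalPseudoRegret_le {d : ℕ} {V : Finset (EuclideanSpace ℝ (Fin d))}
    {Ω : Type*} [MeasurableSpace Ω] {μ : Measure Ω} [IsProbabilityMeasure μ]
    {cost : ℕ → Ω → EuclideanSpace ℝ (Fin d)} {a : EuclideanSpace ℝ (Fin d)} {L R : ℝ}
    (hindep : iIndepFun cost μ) (hm : ∀ i, AEMeasurable (cost i) μ)
    (hmean : ∀ i, ∫ ω, cost i ω ∂μ = a) (ha : ‖a‖ ≤ L) (hR : 0 < R)
    (hb : ∀ i, ∀ᵐ ω ∂μ, ‖cost i ω - a‖ ≤ R)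
    (hgap : ∃ v ∈ V, v ∉ optimalVertices V a)
    {xstar : EuclideanSpace ℝ (Fin d)}
    (hxstar : xstar ∈ convexHull ℝ (V : Set (EuclideanSpace ℝ (Fin d))))
    (hmin : ∀ z ∈ convexHull ℝ (V : Set (EuclideanSpace ℝ (Fin d))),
      (inner ℝ a xstar : ℝ) ≤ inner ℝ a z)
    (y₁ : EuclideanSpace ℝ (Fin d)) {η D M : ℝ} (hη : 0 < η) (hD0 : 0 < D)
    (hD : ∀ v ∈ convexHull ℝ (V : Set (EuclideanSpace ℝ (Fin d))),
      ∀ w ∈ convexHull ℝ (V : Set (EuclideanSpace ℝ (Fin d))), ‖v - w‖ ≤ D)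
    (hM0 : 0 ≤ M)
    (hM : ∀ v ∈ convexHull ℝ (V : Set (EuclideanSpace ℝ (Fin d))), ‖v - y₁‖ ≤ M) :
    (∀ᵐ ω ∂μ, Summable fun n => (inner ℝ a (subgradientAction (convexHull ℝ (V : Set _)) y₁ η
        (fun i => cost i ω) n - xstar) : ℝ)) ∧
      Integrable (fun ω => totalPseudoRegret a xstar fun n =>
        subgradientAction (convexHull ℝ (V : Set _)) y₁ η (fun i => cost i ω) n) μ ∧
      ∫ ω, (totalPseudoRegret a xstar fun n =>
        subgradientAction (convexHull ℝ (V : Set _)) y₁ η (fun i => cost i ω) n) ∂μ ≤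
        L * D + D ^ 2 / suboptimalityGap V a *
          (2 * (M / η) ^ 2 + 88 / 15 * (M / η * R) + 43 / 10 * R ^ 2) := by
  set P := convexHull ℝ (V : Set (EuclideanSpace ℝ (Fin d))) with hP
  have hPc : IsCompact P := V.finite_toSet.isCompact_convexHull ℝ
  have hPne : P.Nonempty := ⟨xstar, hxstar⟩
  have hPconv : Convex ℝ P := convex_convexHull ℝ _
  have hδ := (suboptimalityGap_mem hgap).2
  have hspec : ∀ y, IsNearestPoint P y (euclideanProj P y) := euclideanProj_spec hPc hPne
  set X : ℕ → Ω → EuclideanSpace ℝ (Fin d) := fun i ω => cost i ω - a with hX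
  have hXind : iIndepFun X μ := hindep.comp (fun _ x => x - a) (fun _ => by fun_prop)
  have hXm : ∀ i, AEMeasurable (X i) μ := fun i => (hm i).sub_const a
  have hci : ∀ i, Integrable (cost i) μ := fun i => by
    refine Integrable.of_bound (hm i).aestronglyMeasurable (R + ‖a‖) ?_
    filter_upwards [hb i] with ω h
    calc ‖cost i ω‖ = ‖(cost i ω - a) + a‖ := by rw [sub_add_cancel]
      _ ≤ _ := (norm_add_le _ _).trans (by gcongr)
  have hXz : ∀ i, ∫ ω, X i ω ∂μ = 0 := fun i => by
    rw [hX]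
    simp only
    rw [integral_sub (hci i) (integrable_const a), hmean i]
    simp
  set W : ℕ → Ω → EuclideanSpace ℝ (Fin d) :=
    fun n ω => (√n)⁻¹ • ∑ i ∈ Finset.range n, X i ω with hW
  -- The mean part of the cost sum contributes `n / √n = √n`, the drift.
  have hit : ∀ n : ℕ, 0 < n → ∀ ω, subgradientIterate y₁ η (fun i => cost i ω) n =
      (y₁ - η • W n ω) - (η * √n) • a := fun n hn ω => by
    have hsn : (√(n : ℝ)) ≠ 0 := (Real.sqrt_pos.2 (by exact_mod_cast hn)).ne'
    have hss : √(n : ℝ) * √(n : ℝ) = n := Real.mul_self_sqrt (by positivity)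
    simp only [hW, hX, Finset.sum_sub_distrib, Finset.sum_const, Finset.card_range,
      subgradientIterate, smul_sub, ← Nat.cast_smul_eq_nsmul ℝ, smul_smul]
    have : η * ((√(n : ℝ))⁻¹ * n) = η * √n := by
      congr 1
      rw [inv_mul_eq_div, div_eq_iff hsn, hss]
    rw [this]
    abel
  have hvert : ∀ n : ℕ, 0 < n → ∀ ω,
      inner ℝ a (subgradientAction P y₁ η (fun i => cost i ω) n - xstar) * (η * √n) ≤
        (M + η * ‖W n ω‖) * D ∧
      ((M + η * ‖W n ω‖) * D < suboptimalityGap V a * (η * √n) →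
        inner ℝ a (subgradientAction P y₁ η (fun i => cost i ω) n - xstar) = (0 : ℝ)) :=
    fun n hn ω => by
      have hnp : IsNearestPoint P ((y₁ - η • W n ω) - (η * √n) • a)
          (subgradientAction P y₁ η (fun i => cost i ω) n) := by
        rw [← hit n hn ω]
        exact hspec _
      refine inner_sub_nearestPoint_le hnp hxstar (by positivity) (fun v hv => ?_)
        (fun v hv => gap_eq_zero_or_ge hv hxstar hmin)
      refine (real_inner_le_norm _ _).trans ?_
      have hvP : v ∈ P := subset_convexHull ℝ _ hv
      have h1 := hM _ hnp.1
      set p := subgradientAction P y₁ η (fun i => cost i ω) n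
      have h2 : ‖y₁ - η • W n ω - p‖ ≤ M + η * ‖W n ω‖ := by
        calc _ = ‖-(p - y₁) - η • W n ω‖ := by congr 1; abel
          _ ≤ ‖-(p - y₁)‖ + ‖η • W n ω‖ := norm_sub_le _ _
          _ ≤ _ := by
            rw [norm_neg, norm_smul, Real.norm_of_nonneg hη.le]
            gcongr
      exact mul_le_mul h2 (hD _ hvP _ hxstar) (norm_nonneg _) (by positivity)
  have key := summable_integrable_tsum_of_threshold (μ := μ)
    (f := fun n ω => inner ℝ a (subgradientAction P y₁ η (fun i => cost i ω) n - xstar))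
    (w := fun n ω => ‖W n ω‖) (m := M / η) (A := L * D) hR (by positivity) hD0 hδ
    (fun n ω => ?_) (fun n => ?_) (fun ω => ?_)
    (fun n hn => integral_norm_normalized_sum_le hXind hXm hR.le hb hXz hn)
    (fun n hn t ht => integral_cosh_mul_norm_normalized_sum_le hXind hXm hR hb hXz hn ht)
    (fun n hn ω => ?_) (fun n hn ω hlt => ?_)
  · exact key
  · have := hmin _ (hspec (subgradientIterate y₁ η (fun i => cost i ω) n)).1
    rw [inner_sub_right]
    exact sub_nonneg.2 this
  · have hmi : AEMeasurable (fun ω => subgradientIterate y₁ η (fun i => cost i ω) n) μ := by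
      unfold subgradientIterate
      fun_prop
    have hmp : AEMeasurable (fun ω => subgradientAction P y₁ η (fun i => cost i ω) n) μ :=
      (continuous_euclideanProj hPconv hPc hPne).measurable.comp_aemeasurable hmi
    have : AEMeasurable (fun ω => (inner ℝ a
        (subgradientAction P y₁ η (fun i => cost i ω) n - xstar) : ℝ)) μ := by fun_prop
    exact this.aestronglyMeasurable
  · refine (real_inner_le_norm _ _).trans ?_
    exact mul_le_mul ha (hD _ (hspec _).1 _ hxstar) (norm_nonneg _) ((norm_nonneg a).trans ha)
  · have h := (hvert n hn ω).1
    have e : (M / η + ‖W n ω‖) * D = (M + η * ‖W n ω‖) * D / η := by field_simp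
    rw [e, le_div_iff₀ hη]
    linarith
  · refine (hvert n hn ω).2 ?_
    have e : (M + η * ‖W n ω‖) * D = (M / η + ‖W n ω‖) * D * η := by field_simp
    rw [e]
    have := mul_lt_mul_of_pos_right hlt hη
    linarith

/-! ### Numerical comparison with the stated bounds. -/

theorem exp_neg_two_ge : (27 / 200 : ℝ) ≤ Real.exp (-2) := by
  rw [Real.exp_neg, le_inv_comm₀ (by norm_num) (Real.exp_pos _)]
  have h := Real.exp_one_lt_d9
  have e : Real.exp 2 = Real.exp 1 ^ 2 := by rw [← Real.exp_nat_mul]; norm_num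
  rw [e]
  calc Real.exp 1 ^ 2 ≤ 2.7182818286 ^ 2 := by gcongr
    _ ≤ _ := by norm_num

theorem exp_neg_twenty_five_div_eight_ge : (43 / 1000 : ℝ) ≤ Real.exp (-(25 / 8)) := by
  rw [Real.exp_neg, le_inv_comm₀ (by norm_num) (Real.exp_pos _)]
  have h := Real.exp_one_lt_d9
  have e : Real.exp (25 / 8) = Real.exp 1 ^ 3 * Real.exp (1 / 8) := by
    rw [← Real.exp_nat_mul, ← Real.exp_add]; norm_num
  have h8 : Real.exp (1 / 8) ≤ 8 / 7 := by
    have h1 := Real.add_one_le_exp (-(1 / 8) : ℝ)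
    rw [Real.exp_neg] at h1
    have h2 : (7 / 8 : ℝ) ≤ (Real.exp (1 / 8))⁻¹ := by linarith
    rw [le_inv_comm₀ (by norm_num) (Real.exp_pos _)] at h2
    linarith
  rw [e]
  calc Real.exp 1 ^ 3 * Real.exp (1 / 8) ≤ 2.7182818286 ^ 3 * (8 / 7) := by gcongr
    _ ≤ _ := by norm_num

/-- For `k > 5/2` the main term suffices. For smaller `k` the Gaussian factor is bounded below by
its value at the right end of the range, `k = 2` or `k = 5/2`. -/
theorem quadratic_le_main_add_gaussian {x k : ℝ} (hx : 0 < x) (hk : 0 < k) :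
    2 * x ^ 2 + 88 / 15 * x + 43 / 10 ≤
      9 / 4 * ((x ^ 2 + 1) * (1 + k / x)) + 72 * (1 + x / k) ^ 2 * Real.exp (-(k ^ 2 / 2)) := by
  have hE := Real.exp_pos (-(k ^ 2 / 2))
  have hkx : 0 < k / x := by positivity
  have h1 : x ^ 2 + 1 ≤ (x ^ 2 + 1) * (1 + k / x) := by nlinarith [sq_nonneg x]
  rcases le_or_gt k 2 with h | h
  · have he : (27 / 200 : ℝ) ≤ Real.exp (-(k ^ 2 / 2)) :=
      exp_neg_two_ge.trans (Real.exp_le_exp.2 (by nlinarith))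
    have hxk : x / 2 ≤ x / k := by gcongr
    have : 72 * (1 + x / 2) ^ 2 * (27 / 200) ≤
        72 * (1 + x / k) ^ 2 * Real.exp (-(k ^ 2 / 2)) := by gcongr
    nlinarith
  rcases le_or_gt k (5 / 2) with h' | h'
  · have he : (43 / 1000 : ℝ) ≤ Real.exp (-(k ^ 2 / 2)) :=
      exp_neg_twenty_five_div_eight_ge.trans (Real.exp_le_exp.2 (by nlinarith))
    have hxk : x / (5 / 2) ≤ x / k := by gcongr
    have h2 : 72 * (1 + x / (5 / 2)) ^ 2 * (43 / 1000) ≤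
        72 * (1 + x / k) ^ 2 * Real.exp (-(k ^ 2 / 2)) := by gcongr
    have h3 : x ^ 2 + 1 + 2 * x ≤ (x ^ 2 + 1) * (1 + k / x) := by
      have : 2 * x ≤ x ^ 2 * (k / x) := by
        rw [show x ^ 2 * (k / x) = k * x by field_simp]
        gcongr
      nlinarith
    nlinarith
  · have h3 : (x ^ 2 + 1) * (1 + 5 / 2 / x) ≤ (x ^ 2 + 1) * (1 + k / x) := by gcongr
    have h4 : 2 * x ^ 2 + 88 / 15 * x + 43 / 10 ≤ 9 / 4 * ((x ^ 2 + 1) * (1 + 5 / 2 / x)) := by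
      have e : 9 / 4 * ((x ^ 2 + 1) * (1 + 5 / 2 / x)) =
          9 / 4 * ((x ^ 2 + 1) * (x + 5 / 2)) / x := by field_simp
      rw [e, le_div_iff₀ hx]
      nlinarith [mul_nonneg hx.le (sq_nonneg (x - 2)), sq_nonneg (x - 2)]
    have : 0 ≤ 72 * (1 + x / k) ^ 2 * Real.exp (-(k ^ 2 / 2)) := by positivity
    linarith

/-- Put `x = m / R` and `k = αβm / R`: then `1 + k/x = α/3` and `1 + x/k = 1/(3β)`. The condition `R
≤ 2L` absorbs `R²/2` into `2L²`. -/
theorem quadratic_le_of_gt_three {m R L α β : ℝ} (hm : 0 < m) (hR : 0 < R) (hRL : R ≤ 2 * L)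
    (hα : 3 < α) (hβ : β = 1 / 3 - 1 / α) :
    2 * m ^ 2 + 88 / 15 * (m * R) + 43 / 10 * R ^ 2 ≤
      (m ^ 2 / 2 + 2 * L ^ 2) * (3 / 2 * α) +
        8 * R ^ 2 / β ^ 2 * Real.exp (-(1 / 2) * (α * β * m / R) ^ 2) := by
  have hα0 : 0 < α := by linarith
  have hab : α * β = α / 3 - 1 := by rw [hβ]; field_simp
  have hε : 0 < α / 3 - 1 := by linarith
  have h := quadratic_le_main_add_gaussian (x := m / R) (k := α * β * m / R) (by positivity)
    (by rw [hab]; positivity)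
  have hβ0 : 0 < β := by
    by_contra! hn
    nlinarith
  have e1 : 1 + α * β * m / R / (m / R) = α / 3 := by
    rw [show α * β * m / R / (m / R) = α * β by field_simp, hab]; ring
  have e2 : 1 + m / R / (α * β * m / R) = 1 / (3 * β) := by
    have : m / R / (α * β * m / R) = 1 / (α * β) := by field_simp
    have h3 : (1 + 1 / (α * β)) * (3 * β) = 3 * β + 3 / α := by field_simp
    rw [this, eq_div_iff (by positivity), h3, hβ]
    ring
  rw [e1, e2] at h
  have h2 := mul_le_mul_of_nonneg_left h (sq_nonneg R)
  have e3 : R ^ 2 * (2 * (m / R) ^ 2 + 88 / 15 * (m / R) + 43 / 10) =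
      2 * m ^ 2 + 88 / 15 * (m * R) + 43 / 10 * R ^ 2 := by field_simp
  have e4 : R ^ 2 * (9 / 4 * (((m / R) ^ 2 + 1) * (α / 3)) + 72 * (1 / (3 * β)) ^ 2 *
      Real.exp (-((α * β * m / R) ^ 2 / 2))) =
      (m ^ 2 / 2 + R ^ 2 / 2) * (3 / 2 * α) +
        8 * R ^ 2 / β ^ 2 * Real.exp (-(1 / 2) * (α * β * m / R) ^ 2) := by
    rw [show -((α * β * m / R) ^ 2 / 2) = -(1 / 2) * (α * β * m / R) ^ 2 by ring]
    field_simp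
    ring
  rw [e3, e4] at h2
  have h3 : R ^ 2 ≤ 4 * L ^ 2 := by nlinarith
  refine h2.trans ?_
  gcongr
  linarith

/-- Comparison of the elementary quadratic bound with the bound that has a Gaussian correction. -/
theorem regret_bound_le {B A D Δ Δd η m R L α β : ℝ} (hD : 0 < D) (hΔ : 0 < Δ)
    (hΔd : 0 ≤ Δd) (hη : 0 < η) (hm : 0 < m) (hR : 0 ≤ R) (hL : 0 < L)
    (hα : 3 < α) (hβ : β = 1 / 3 - 1 / α)
    (hB : ∀ r, 0 < r → min R (2 * L) ≤ r →
      B ≤ A + D ^ 2 / Δ * (2 * m ^ 2 + 88 / 15 * (m * r) + 43 / 10 * r ^ 2)) :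
    B ≤ A + ((m * η) ^ 2 / (2 * η) + 2 * η * L ^ 2 + √(Real.pi / 2) * R * D) *
        (3 / 2 * (α * D ^ 2 / (η * Δ)) + η * Δ / (α * D ^ 2)) +
      4 * R ^ 2 * D ^ 2 / β ^ 2 * (1 / Δd + 2 / Δ) *
        Real.exp (-(1 / 2) * (α * β * (m * η) / (η * R)) ^ 2) := by
  have hα0 : 0 < α := by linarith
  have hab : α * β = α / 3 - 1 := by rw [hβ]; field_simp
  have hab0 : 0 ≤ α * β := by rw [hab]; linarith
  have hmain : D ^ 2 / Δ * ((m ^ 2 / 2 + 2 * L ^ 2) * (3 / 2 * α)) ≤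
      ((m * η) ^ 2 / (2 * η) + 2 * η * L ^ 2 + √(Real.pi / 2) * R * D) *
        (3 / 2 * (α * D ^ 2 / (η * Δ)) + η * Δ / (α * D ^ 2)) := by
    calc _ = ((m * η) ^ 2 / (2 * η) + 2 * η * L ^ 2) * (3 / 2 * (α * D ^ 2 / (η * Δ))) := by
          field_simp
      _ ≤ _ := by
          exact mul_le_mul (le_add_of_nonneg_right (by positivity))
            (le_add_of_nonneg_right (by positivity)) (by positivity) (by positivity)
  have hDΔ : 0 < D ^ 2 / Δ := by positivity
  rcases hR.eq_or_lt with rfl | hR0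
  -- Noise-free case: the quadratic bound needs a positive `r`, and the factor `3α/2 > 9/2` leaves
  -- room for a small multiple of `m`.
  · have h := hB (m / 100) (by positivity) (by rw [min_eq_left (by positivity : (0 : ℝ) ≤ 2 * L)]; positivity)
    have h2 : D ^ 2 / Δ * (2 * m ^ 2 + 88 / 15 * (m * (m / 100)) + 43 / 10 * (m / 100) ^ 2) ≤
        D ^ 2 / Δ * ((m ^ 2 / 2 + 2 * L ^ 2) * (3 / 2 * α)) := by
      refine mul_le_mul_of_nonneg_left ?_ hDΔ.le
      have : (m ^ 2 / 2 + 2 * L ^ 2) * (3 / 2 * 3) ≤ (m ^ 2 / 2 + 2 * L ^ 2) * (3 / 2 * α) := by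
        gcongr
      nlinarith [sq_nonneg m, sq_nonneg L]
    have e : 4 * (0 : ℝ) ^ 2 * D ^ 2 / β ^ 2 * (1 / Δd + 2 / Δ) *
        Real.exp (-(1 / 2) * (α * β * (m * η) / (η * 0)) ^ 2) = 0 := by simp
    rw [e]
    linarith
  -- `r ≤ 2L` is what the quadratic comparison needs; `r ≤ R` lets the Gaussian term increase to the
  -- stated one.
  set r := min R (2 * L) with hr
  have hr0 : 0 < r := lt_min hR0 (by positivity)
  have hrR : r ≤ R := min_le_left _ _
  have h := hB r hr0 le_rfl
  have hq := quadratic_le_of_gt_three hm hr0 (min_le_right R (2 * L)) hα hβ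
  have hq2 := mul_le_mul_of_nonneg_left hq hDΔ.le
  have hlast : D ^ 2 / Δ * (8 * r ^ 2 / β ^ 2 * Real.exp (-(1 / 2) * (α * β * m / r) ^ 2)) ≤
      4 * R ^ 2 * D ^ 2 / β ^ 2 * (1 / Δd + 2 / Δ) *
        Real.exp (-(1 / 2) * (α * β * (m * η) / (η * R)) ^ 2) := by
    have e : α * β * (m * η) / (η * R) = α * β * m / R := by field_simp
    have hexp : Real.exp (-(1 / 2) * (α * β * m / r) ^ 2) ≤
        Real.exp (-(1 / 2) * (α * β * m / R) ^ 2) := by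
      apply Real.exp_le_exp.2
      have : (α * β * m / R) ^ 2 ≤ (α * β * m / r) ^ 2 := by gcongr
      linarith
    rw [e]
    calc _ = 4 * r ^ 2 * D ^ 2 / β ^ 2 * (2 / Δ) *
          Real.exp (-(1 / 2) * (α * β * m / r) ^ 2) := by ring
      _ ≤ _ := by
          gcongr
          exact le_add_of_nonneg_left (by positivity)
  rw [mul_add] at hq2
  linarith

/-! ### The main theorem. -/

theorem theorem3 :
    ∃ C : ℝ, ∀ (d : ℕ) (V : Finset (EuclideanSpace ℝ (Fin d)))
      (P : Set (EuclideanSpace ℝ (Fin d))) (_hP : P = convexHull ℝ (V : Set _))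
      (Ω : Type*) [MeasurableSpace Ω] (μ : Measure Ω) [IsProbabilityMeasure μ]
      (cost : ℕ → Ω → EuclideanSpace ℝ (Fin d)) (a : EuclideanSpace ℝ (Fin d)) (L R : ℝ)
      (_hindep : iIndepFun cost μ)
      (_hident : ∀ i, IdentDistrib (cost i) (cost 0) μ μ)
      (_hmean : ∀ i, ∫ ω, cost i ω ∂μ = a)
      (_hL : ∀ i, ∀ᵐ ω ∂μ, ‖cost i ω‖ ≤ L)
      (_hR : ∀ i, ∀ᵐ ω ∂μ, ‖cost i ω - a‖ ≤ R)
      -- some vertex is not optimal, so that the suboptimality gap is defined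
      (_hgap : ∃ v ∈ V, v ∉ optimalVertices V a)
      (xstar : EuclideanSpace ℝ (Fin d)) (_hxstar : xstar ∈ P)
      (_hmin : ∀ z ∈ P, inner ℝ a xstar ≤ inner ℝ a z)
      (y₁ : EuclideanSpace ℝ (Fin d)) (η : ℝ) (_hη : 0 < η)
      (x : ℕ → Ω → EuclideanSpace ℝ (Fin d))
      (_hx : ∀ n ω, x n ω = subgradientAction P y₁ η (fun i => cost i ω) n)
      (D Δ Δd M : ℝ) (_hD : D = Metric.diam P) (_hΔ : Δ = suboptimalityGap V a)
      (_hΔd : Δd = largestGap V a) (_hM : M = maxDistTo P y₁),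
      (∀ᵐ ω ∂μ, Summable fun n => inner ℝ a (x n ω - xstar)) ∧
      Integrable (fun ω => totalPseudoRegret a xstar fun n => x n ω) μ ∧
      (∀ α β : ℝ, 3 < α → β = 1 / 3 - 1 / α →
        ∫ ω, totalPseudoRegret a xstar (fun n => x n ω) ∂μ ≤
          L * D
            + (M ^ 2 / (2 * η) + 2 * η * L ^ 2 + Real.sqrt (Real.pi / 2) * R * D)
              * (3 / 2 * (α * D ^ 2 / (η * Δ)) + η * Δ / (α * D ^ 2))
            + 4 * R ^ 2 * D ^ 2 / β ^ 2 * (1 / Δd + 2 / Δ)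
              * Real.exp (-(1 / 2) * (α * β * M / (η * R)) ^ 2)) ∧
      (y₁ ∈ P → η = D / (2 * L) →
        ∫ ω, totalPseudoRegret a xstar (fun n => x n ω) ∂μ ≤
            (2 * L * D + Real.sqrt (Real.pi / 2) * R * D) * (30 * L * D / Δ + 11 / 20)
              + 15 * R ^ 2 * D ^ 2 / Δ ∧
        ∫ ω, totalPseudoRegret a xstar (fun n => x n ω) ∂μ ≤ C * (L ^ 2 * D ^ 2 / Δ)) := by
  -- With noise bound `2L` the quadratic form is at most `49 L²`; the first round adds one more
  -- unit, as `Δ ≤ LD`.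
  refine ⟨50, ?_⟩
  intro d V P hP Ω _ μ _ cost a L R hindep hident hmean hL hR hgap xstar hxstar hmin y₁ η hη x hx
    D Δ Δd M hD hΔ hΔd hM
  subst hP
  obtain rfl : x = fun n ω =>
      subgradientAction (convexHull ℝ (V : Set _)) y₁ η (fun i => cost i ω) n := by
    funext n ω; exact hx n ω
  have hPc : IsCompact (convexHull ℝ (V : Set (EuclideanSpace ℝ (Fin d)))) :=
    V.finite_toSet.isCompact_convexHull ℝ
  have hm : ∀ i, AEMeasurable (cost i) μ := fun i => (hident i).aemeasurable_fst
  have ha : ‖a‖ ≤ L := by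
    rw [← hmean 0]
    simpa using norm_integral_le_of_norm_le_const (hL 0)
  have hdiam : ∀ v ∈ convexHull ℝ (V : Set (EuclideanSpace ℝ (Fin d))),
      ∀ w ∈ convexHull ℝ (V : Set (EuclideanSpace ℝ (Fin d))), ‖v - w‖ ≤ D := fun v hv w hw => by
    rw [hD, ← dist_eq_norm]
    exact Metric.dist_le_diam_of_mem hPc.isBounded hv hw
  have hMd : ∀ v ∈ convexHull ℝ (V : Set (EuclideanSpace ℝ (Fin d))), ‖v - y₁‖ ≤ M :=
    fun v hv => hM ▸ norm_sub_le_maxDistTo hPc y₁ hv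
  obtain ⟨⟨v, hv, w, hw, hvw⟩, hΔ0⟩ := suboptimalityGap_mem hgap
  rw [← hΔ] at hvw hΔ0
  have hvP := subset_convexHull ℝ (V : Set (EuclideanSpace ℝ (Fin d))) hv
  have hwP := subset_convexHull ℝ (V : Set (EuclideanSpace ℝ (Fin d))) hw.1
  have hne : 0 < ‖a‖ * ‖v - w‖ := hΔ0.trans_le (hvw ▸ real_inner_le_norm _ _)
  have hvw0 : 0 < ‖v - w‖ := pos_of_mul_pos_right hne (norm_nonneg _)
  have hL0 : 0 < L := (pos_of_mul_pos_left hne (norm_nonneg _)).trans_le ha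
  have hD0 : 0 < D := hvw0.trans_le (hdiam v hvP w hwP)
  have hΔLD : Δ ≤ L * D := by
    rw [hvw]
    refine (real_inner_le_norm _ _).trans ?_
    exact mul_le_mul ha (hdiam v hvP w hwP) (norm_nonneg _) hL0.le
  have hM0 : 0 < M := by
    have h1 := hMd v hvP
    have h2 := hMd w hwP
    have h3 : ‖v - w‖ ≤ ‖v - y₁‖ + ‖w - y₁‖ := by
      rw [show v - w = (v - y₁) - (w - y₁) by abel]
      exact norm_sub_le _ _
    linarith
  have hR0 : 0 ≤ R := by
    obtain ⟨ω, hω⟩ := (hR 0).exists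
    exact (norm_nonneg _).trans hω
  have hb : ∀ r, min R (2 * L) ≤ r → ∀ i, ∀ᵐ ω ∂μ, ‖cost i ω - a‖ ≤ r := fun r hr i => by
    filter_upwards [hR i, hL i] with ω h1 h2
    refine le_trans (le_min h1 ?_) hr
    calc _ ≤ ‖cost i ω‖ + ‖a‖ := norm_sub_le _ _
      _ ≤ _ := by linarith
  have hbase := fun (r : ℝ) (hr0 : 0 < r) (hr : min R (2 * L) ≤ r) =>
    totalPseudoRegret_le hindep hm hmean ha hr0 (hb r hr) hgap hxstar hmin y₁ hη hD0 hdiam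
      hM0.le hMd
  -- Convergence and integrability need only some positive noise bound; `R` itself may be zero.
  obtain ⟨hsum, hint, -⟩ := hbase (R + 1) (by linarith) ((min_le_left _ _).trans (by linarith))
  refine ⟨hsum, hint, fun α β hα hβ => ?_, fun hy hη' => ?_⟩
  · have h := regret_bound_le (m := M / η) (R := R) hD0 hΔ0 (hΔd ▸ largestGap_nonneg) hη
      (by positivity) hR0 hL0 hα hβ (fun r hr0 hr => hΔ ▸ (hbase r hr0 hr).2.2)
    rwa [div_mul_cancel₀ M hη.ne'] at h
  · have hMD : M ≤ D := by
      rw [hM]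
      refine csSup_le ⟨_, ⟨_, hy, rfl⟩⟩ ?_
      rintro _ ⟨z, hz, rfl⟩
      exact hdiam z hz y₁ hy
    -- A base point in the polytope gives `M ≤ D`.
    have hm2 : M / η ≤ 2 * L := by
      rw [div_le_iff₀ hη, hη']
      calc M ≤ D := hMD
        _ = _ := by field_simp
    have hm0 : 0 < M / η := by positivity
    have hbound : ∀ r, 0 < r → min R (2 * L) ≤ r →
        ∫ ω, (totalPseudoRegret a xstar fun n =>
          subgradientAction (convexHull ℝ (V : Set _)) y₁ η (fun i => cost i ω) n) ∂μ ≤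
        L * D + D ^ 2 / Δ * (8 * L ^ 2 + 176 / 15 * (L * r) + 43 / 10 * r ^ 2) :=
      fun r hr0 hr => by
        refine ((hbase r hr0 hr).2.2).trans ?_
        rw [← hΔ]
        have h1 : (M / η) ^ 2 ≤ (2 * L) ^ 2 := by gcongr
        have h2 : M / η * r ≤ 2 * L * r := by gcongr
        exact add_le_add_right (mul_le_mul_of_nonneg_left (by linarith) (by positivity)) _
    have hDΔ : 0 < D ^ 2 / Δ := by positivity
    constructor
    · have hroot : 1 ≤ √(Real.pi / 2) := by
        rw [Real.one_le_sqrt]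
        linarith [Real.pi_gt_three]
      have hrhs : 2 * L * D * (11 / 20) + D ^ 2 / Δ * (60 * L ^ 2 + 30 * (L * R) + 15 * R ^ 2) ≤
          (2 * L * D + √(Real.pi / 2) * R * D) * (30 * L * D / Δ + 11 / 20) +
            15 * R ^ 2 * D ^ 2 / Δ := by
        calc _ = 2 * L * D * (30 * L * D / Δ + 11 / 20) + 1 * R * D * (30 * L * D / Δ) +
              15 * R ^ 2 * D ^ 2 / Δ := by field_simp; ring
          _ ≤ 2 * L * D * (30 * L * D / Δ + 11 / 20) +
              √(Real.pi / 2) * R * D * (30 * L * D / Δ + 11 / 20) +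
              15 * R ^ 2 * D ^ 2 / Δ := by
              gcongr
              linarith
          _ = _ := by ring
      refine le_trans ?_ hrhs
      rcases hR0.eq_or_lt with h | h
      -- For `R = 0` the positive value `r = L` is affordable, since `60 L²` leaves enough slack.
      · refine (hbound L hL0 ((min_le_left _ _).trans (h ▸ hL0.le))).trans ?_
        have : D ^ 2 / Δ * (8 * L ^ 2 + 176 / 15 * (L * L) + 43 / 10 * L ^ 2) ≤
            D ^ 2 / Δ * (60 * L ^ 2 + 30 * (L * R) + 15 * R ^ 2) := by
          refine mul_le_mul_of_nonneg_left ?_ hDΔ.le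
          rw [← h]
          nlinarith
        linarith
      · refine (hbound R h (min_le_left _ _)).trans ?_
        have : D ^ 2 / Δ * (8 * L ^ 2 + 176 / 15 * (L * R) + 43 / 10 * R ^ 2) ≤
            D ^ 2 / Δ * (60 * L ^ 2 + 30 * (L * R) + 15 * R ^ 2) := by
          have := mul_pos hL0 h
          gcongr <;> norm_num
        linarith
    · refine (hbound (2 * L) (by positivity) (min_le_right _ _)).trans ?_
      have h1 : L * D ≤ L ^ 2 * D ^ 2 / Δ := by
        rw [le_div_iff₀ hΔ0]
        calc L * D * Δ ≤ L * D * (L * D) := by gcongr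
          _ = _ := by ring
      have h2 : D ^ 2 / Δ * (8 * L ^ 2 + 176 / 15 * (L * (2 * L)) + 43 / 10 * (2 * L) ^ 2) ≤
          49 * (L ^ 2 * D ^ 2 / Δ) := by
        calc _ ≤ D ^ 2 / Δ * (49 * L ^ 2) := mul_le_mul_of_nonneg_left (by nlinarith) hDΔ.le
          _ = _ := by ring
      linarith
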